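/- Let $\mathcal H_A,\mathcal H_B,\mathcal H_C$ be finite-dimensional complex Hilbert spaces and let $\rho_{ABC}$ be a positive definite density operator on $\mathcal H_A\otimes\mathcal H_B\otimes\mathcal H_C$, with marginals $\rho_{AC},\rho_{BC},\rho_C$ (operators on a subset of the systems are understood to be tensored with the identity on the others). Put $$\omega_{ABC}=\rho_{AC}^{1/2}\,\rho_C^{-1/2}\,\rho_{BC}\,\rho_C^{-1/2}\,\rho_{AC}^{1/2},$$ $$I_{\max}(A;B|C)_\rho=\inf\{\lambda\in\mathbb R:\ \rho_{ABC}\le e^{\lambda}\,\omega_{ABC}\},\qquad I_{\min}(A;B|C)_\rho=-\log\big\|\sqrt{\rho_{ABC}}\sqrt{\omega_{ABC}}\big\|_1^2,$$ where $\le$ is the Loewner order, $\log$ is the natural logarithm and $\|X\|_1=\operatorname{Tr}\sqrt{X^\dagger X}$. Call $\rho_{ABC}$ a short quantum Markov chain $A-C-B$ if its conditional mutual information $I(A;B|C)_\rho=H(AC)_\rho+H(BC)_\rho-H(C)_\rho-H(ABC)_\rho$ equals $0$, where $H(F)_\rho=-\operatorname{Tr}\{\rho_F\log\rho_F\}$.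 Then $$I_{\max}(A;B|C)_\rho=0\iff\rho_{ABC}\text{ is a short quantum Markov chain }A-C-B,$$ $$I_{\min}(A;B|C)_\rho=0\iff\rho_{ABC}\text{ is a short quantum Markov chain }A-C-B.$$ -/

import Mathlib

open scoped ComplexOrder Kronecker Matrix

noncomputable section

namespace QInfo

section General

variable {n : Type*} [Fintype n] [DecidableEq n]

/-- A density operator on the Hilbert space `ℂⁿ`: positive semidefinite with unit trace. -/
structure IsDensity (ρ : Matrix n n ℂ) : Prop where
  posSemidef : ρ.PosSemidef
  trace_eq_one : ρ.trace = 1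

/-- A positive definite density operator on the Hilbert space `ℂⁿ`. -/
structure IsPosDefDensity (ρ : Matrix n n ℂ) : Prop where
  posDef : ρ.PosDef
  trace_eq_one : ρ.trace = 1

/-- The power `A ^ s` of a positive semidefinite matrix, through the spectral decomposition.
For `s ≠ 0` the kernel of `A` is sent to `0` (also for `s < 0`), as `0 ^ s = 0`. -/
def mpow (A : Matrix n n ℂ) (s : ℝ) : Matrix n n ℂ :=
  cfc (fun x : ℝ => x ^ s) A

/-- The logarithm of a positive semidefinite matrix, through the spectral decomposition
(equal to `0` on the kernel). -/
def mlog (A : Matrix n n ℂ) : Matrix n n ℂ :=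
  cfc Real.log A

/-- The von Neumann entropy `H(σ) = -Tr (σ log σ)`. -/
def entropy (σ : Matrix n n ℂ) : ℝ :=
  -(σ * mlog σ).trace.re

/-- The trace norm `‖X‖₁ = Tr √(Xᴴ X)`. -/
def traceNorm (X : Matrix n n ℂ) : ℝ :=
  (mpow (Xᴴ * X) (1 / 2)).trace.re

/-- The fidelity `F(ρ, σ) = ‖√ρ √σ‖₁²`. -/
def fidelity (ρ σ : Matrix n n ℂ) : ℝ :=
  traceNorm (mpow ρ (1 / 2) * mpow σ (1 / 2)) ^ 2

/-- The min-relative entropy `-log F(ρ, σ)`, which is `+∞` when the fidelity vanishes. -/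
def dMin (ρ σ : Matrix n n ℂ) : EReal :=
  -ENNReal.log (ENNReal.ofReal (fidelity ρ σ))

/-- The max-relative entropy `inf {l : ρ ≤ exp(l) σ}` for the Loewner order, which is `+∞`
when no such `l` exists. -/
def dMax (ρ σ : Matrix n n ℂ) : EReal :=
  sInf ((fun l : ℝ => (l : EReal)) '' {l : ℝ | (Real.exp l • σ - ρ).PosSemidef})

end General

section Tripartite

variable {a b c : Type*} [Fintype a] [Fintype b] [Fintype c]
  [DecidableEq a] [DecidableEq b] [DecidableEq c]

/-- The marginal on `AC`, i.e. the partial trace over `B`. -/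
def margAC (ρ : Matrix (a × b × c) (a × b × c) ℂ) : Matrix (a × c) (a × c) ℂ :=
  Matrix.of fun x y => ∑ j, ρ (x.1, j, x.2) (y.1, j, y.2)

/-- The marginal on `BC`, i.e. the partial trace over `A`. -/
def margBC (ρ : Matrix (a × b × c) (a × b × c) ℂ) : Matrix (b × c) (b × c) ℂ :=
  Matrix.of fun x y => ∑ i, ρ (i, x) (i, y)

/-- The marginal on `C`, i.e. the partial trace over `A` and `B`. -/
def margC (ρ : Matrix (a × b × c) (a × b × c) ℂ) : Matrix c c ℂ :=
  Matrix.of fun x y => ∑ i, ∑ j, ρ (i, j, x) (i, j, y)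

/-- An operator on `AC` as an operator on `ABC`, acting as the identity on `B`. -/
def liftAC (X : Matrix (a × c) (a × c) ℂ) : Matrix (a × b × c) (a × b × c) ℂ :=
  ((1 : Matrix b b ℂ) ⊗ₖ X).submatrix
    (fun x => (x.2.1, (x.1, x.2.2))) (fun x => (x.2.1, (x.1, x.2.2)))

/-- An operator on `BC` as an operator on `ABC`, acting as the identity on `A`. -/
def liftBC (X : Matrix (b × c) (b × c) ℂ) : Matrix (a × b × c) (a × b × c) ℂ :=
  (1 : Matrix a a ℂ) ⊗ₖ X

/-- An operator on `C` as an operator on `ABC`, acting as the identity on `A` and `B`. -/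
def liftC (X : Matrix c c ℂ) : Matrix (a × b × c) (a × b × c) ℂ :=
  (1 : Matrix a a ℂ) ⊗ₖ ((1 : Matrix b b ℂ) ⊗ₖ X)

/-- The conditional mutual information `I(A;B|C) = H(AC) + H(BC) - H(C) - H(ABC)`. -/
def condMutualInfo (ρ : Matrix (a × b × c) (a × b × c) ℂ) : ℝ :=
  entropy (margAC ρ) + entropy (margBC ρ) - entropy (margC ρ) - entropy ρ

/-- A short quantum Markov chain `A - C - B`: a tripartite density operator whose conditional
mutual information `I(A;B|C)` vanishes. -/
def IsShortMarkovChain (ρ : Matrix (a × b × c) (a × b × c) ℂ) : Prop :=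
  IsDensity ρ ∧ condMutualInfo ρ = 0

/-- The operator `ρ_AC^(1/2) ρ_C^(-1/2) ρ_BC ρ_C^(-1/2) ρ_AC^(1/2)` on `ABC`. -/
def petzState (ρ : Matrix (a × b × c) (a × b × c) ℂ) : Matrix (a × b × c) (a × b × c) ℂ :=
  liftAC (mpow (margAC ρ) (1 / 2)) * liftC (mpow (margC ρ) (-(1 / 2))) * liftBC (margBC ρ) *
    liftC (mpow (margC ρ) (-(1 / 2))) * liftAC (mpow (margAC ρ) (1 / 2))

/-- The max-conditional mutual information `I_max(A;B|C)`. -/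
def iMax (ρ : Matrix (a × b × c) (a × b × c) ℂ) : EReal :=
  dMax ρ (petzState ρ)

/-- The min-conditional mutual information `I_min(A;B|C)`. -/
def iMin (ρ : Matrix (a × b × c) (a × b × c) ℂ) : EReal :=
  dMin ρ (petzState ρ)

end Tripartite

end QInfo

end

/-!
Write `ω` for `petzState ρ`. Both `ρ` and `ω` are positive definite of trace one. A divergence of
either kind between two such operators vanishes only if they coincide: for `dMax` because
`ω - ρ` is then positive semidefinite and traceless (`dMax_eq_zero_iff`), for `dMin` because the
polar decomposition turns fidelity one into equality of the square roots up to a unitary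
(`dMin_eq_zero_iff`). Everything therefore rests on the equivalence of `ρ = ω` with
`condMutualInfo ρ = 0`, which is Petz's characterization of equality in strong subadditivity.

The conditional mutual information is the difference of relative entropies
`D(ρ_ABC ‖ ρ_AC ⊗ 1_B) - D(ρ_BC ‖ 1_B ⊗ ρ_C)`. Under the trace over `A` the first pair goes to
the second one, and if `ρ = ω` then the Petz recovery channel `X ↦ K X Kᴴ`, where
`K = ρ_AC^(1/2) ρ_C^(-1/2)`, sends the second pair back to the first. Monotonicity of the relative
entropy in both directions gives `condMutualInfo ρ = 0`.

Monotonicity is proved through the solution `Z` of the Sylvester equation `σ Z + s Z ρ = ρ`, which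
is the resolvent `(Δ + s)⁻¹` of the modular operator `Δ X = σ X ρ⁻¹` applied to `1`. It maximizes
the concave function `2 Re Tr ρZ - Tr σ Z Zᴴ - s Tr ρ Zᴴ Z` with maximal value `Re Tr ρZ`, and a
map satisfying Schwarz inequalities (`IsSchwarzPullback`) can only increase this function. In the
eigenbases of `σ` and `ρ` the maximal value is a finite sum `∑ w (s + t)⁻¹` while `D(ρ ‖ σ)` is
`-∑ w log t` with the same weights, and a comparison of the first for all `s > 0` integrates to a
comparison of the second (`sum_mul_log_add_le`).

If the relative entropies agree, then so do the maximal values for every `s > 0`, and by strict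
concavity the maximizers correspond to each other. The functions `t ↦ (s + t)⁻¹` span all
functions on a finite set of positive reals (`exists_sum_inv_add_eq`), so the same correspondence
holds for every function of `Δ`, in particular for the square root. This reads
`σ^(1/2) ρ^(-1/2) = σ'^(1/2) ρ'^(-1/2)`, where `σ = ρ_AC`, `σ' = ρ_C` and `ρ' = ρ_BC`, and it
rearranges to `ρ = ω` (`eq_petzState_of_condMutualInfo_eq_zero`).
-/

noncomputable section

namespace QInfo

/-! ### Sums of logarithms and of resolvent functions -/

open Filter Topology

/-- On a finite set `T` of positive reals, every function is a linear combination of the functions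
`t ↦ (s + t)⁻¹` with `s ∈ T`. -/
theorem exists_sum_inv_add_eq (T : Finset ℝ) (hT : ∀ t ∈ T, 0 < t) (f : ℝ → ℝ) :
    ∃ c : ℝ → ℝ, ∀ t ∈ T, f t = ∑ s ∈ T, c s * (s + t)⁻¹ := by
  set r : ℝ → ℝ := fun t => f t * ∏ u ∈ T, (u + t)
  have hinj : Set.InjOn (fun x : ℝ => x) (T : Set ℝ) := fun _ _ _ _ h => h
  have hneg : Set.InjOn (fun x : ℝ => -x) (T : Set ℝ) := fun _ _ _ _ h => neg_injective h
  -- `P` agrees on `T` with `f` times the common denominator. Dividing it by that denominator and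
  -- expanding in partial fractions, which is Lagrange interpolation of `P` at the nodes `-u`,
  -- gives the combination.
  set P := Lagrange.interpolate T (fun x : ℝ => x) r
  refine ⟨fun s => Lagrange.nodalWeight T (fun x : ℝ => -x) s * P.eval (-s), fun t ht => ?_⟩
  have hP : P.eval t = r t := Lagrange.eval_interpolate_at_node r hinj ht
  have hP' : P = Lagrange.interpolate T (fun x : ℝ => -x) (fun s => P.eval (-s)) :=
    Lagrange.eq_interpolate hneg (Lagrange.degree_interpolate_lt r hinj)
  have hne : ∀ u ∈ T, t ≠ -u := fun u hu => by linarith [hT u hu, hT t ht]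
  have hE := Lagrange.eval_interpolate_not_at_node (s := T) (v := fun x : ℝ => -x) (x := t)
    (fun s => P.eval (-s)) hne
  rw [← hP', hP, Lagrange.eval_nodal] at hE
  have hprod : ∏ u ∈ T, (t - -u) = ∏ u ∈ T, (u + t) :=
    Finset.prod_congr rfl fun u _ => by ring
  have hpos : ∏ u ∈ T, (u + t) ≠ 0 :=
    Finset.prod_ne_zero_iff.2 fun u hu => by linarith [hT u hu, hT t ht]
  have hr : r t = (∏ u ∈ T, (u + t)) * f t := mul_comm _ _
  rw [hprod, hr] at hE
  refine (mul_left_cancel₀ hpos hE).trans ?_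
  refine Finset.sum_congr rfl fun u _ => ?_
  rw [sub_neg_eq_add, add_comm t u]
  ring

section Stieltjes

variable {ι κ : Type*} [Fintype ι] [Fintype κ] {w t : ι → ℝ} {w' t' : κ → ℝ}

theorem tendsto_sum_mul_log_add_sub (w t : ι → ℝ) :
    Tendsto (fun s : ℝ => ∑ i, w i * Real.log (s + t i) - (∑ i, w i) * Real.log s)
      atTop (𝓝 0) := by
  have h : ∀ i, Tendsto (fun s : ℝ => w i * (Real.log (s + t i) - Real.log s)) atTop (𝓝 0) := by
    intro i
    have h1 : Tendsto (fun s : ℝ => 1 + t i / s) atTop (𝓝 (1 + 0)) :=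
      tendsto_const_nhds.add (tendsto_const_nhds.div_atTop tendsto_id)
    have h2 := ((Real.continuousAt_log (by norm_num : (1 + 0 : ℝ) ≠ 0)).tendsto.comp h1).const_mul
      (w i)
    simp only [add_zero, Real.log_one, mul_zero] at h2
    refine h2.congr' ?_
    filter_upwards [eventually_gt_atTop 0, eventually_gt_atTop (-t i)] with s hs hs'
    rw [Function.comp_apply, ← Real.log_div (by linarith) hs.ne']
    congr 2
    field_simp
  have := tendsto_finsetSum (Finset.univ : Finset ι) fun i _ => h i
  simpa [mul_sub, Finset.sum_sub_distrib, Finset.sum_mul] using this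

theorem hasDerivAt_sum_mul_log_add (ht : ∀ i, 0 < t i) {s : ℝ} (hs : 0 ≤ s) :
    HasDerivAt (fun s : ℝ => ∑ i, w i * Real.log (s + t i)) (∑ i, w i * (s + t i)⁻¹) s := by
  refine HasDerivAt.fun_sum fun i _ => ?_
  have hne : id s + t i ≠ 0 := (add_pos_of_nonneg_of_pos hs (ht i)).ne'
  have := (((hasDerivAt_id s).add_const (t i)).log hne).const_mul (w i)
  simpa using this

variable (ht : ∀ i, 0 < t i) (ht' : ∀ k, 0 < t' k) (hw : ∑ i, w i = ∑ k, w' k)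
  (h : ∀ s, 0 < s → ∑ k, w' k * (s + t' k)⁻¹ ≤ ∑ i, w i * (s + t i)⁻¹)

include ht ht' h in
theorem monotoneOn_sum_mul_log_add_sub :
    MonotoneOn (fun s : ℝ => ∑ i, w i * Real.log (s + t i) - ∑ k, w' k * Real.log (s + t' k))
      (Set.Ici 0) := by
  have hd : ∀ s : ℝ, 0 ≤ s → HasDerivAt
      (fun s : ℝ => ∑ i, w i * Real.log (s + t i) - ∑ k, w' k * Real.log (s + t' k))
      (∑ i, w i * (s + t i)⁻¹ - ∑ k, w' k * (s + t' k)⁻¹) s := fun s hs =>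
    (hasDerivAt_sum_mul_log_add ht hs).sub (hasDerivAt_sum_mul_log_add ht' hs)
  refine monotoneOn_of_deriv_nonneg (convex_Ici 0)
    (fun s hs => (hd s hs).continuousAt.continuousWithinAt)
    (fun s hs => ?_) fun s hs => ?_
  · rw [interior_Ici] at hs
    exact (hd s (le_of_lt hs)).differentiableAt.differentiableWithinAt
  · rw [interior_Ici] at hs
    rw [(hd s (le_of_lt hs)).deriv]
    exact sub_nonneg.2 (h s hs)

include ht ht' hw h in
/-- The difference of the two sides is nondecreasing in `s`, because its derivative is the
difference of the resolvent sums, and it tends to `0` at infinity, because the total weights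
agree. -/
theorem sum_mul_log_add_le {s : ℝ} (hs : 0 ≤ s) :
    ∑ i, w i * Real.log (s + t i) ≤ ∑ k, w' k * Real.log (s + t' k) := by
  have hlim := (tendsto_sum_mul_log_add_sub w t).sub (tendsto_sum_mul_log_add_sub w' t')
  rw [sub_zero] at hlim
  refine sub_nonpos.1 (ge_of_tendsto hlim ?_)
  filter_upwards [eventually_ge_atTop s] with u hu
  have := monotoneOn_sum_mul_log_add_sub ht ht' h (Set.mem_Ici.2 hs)
    (Set.mem_Ici.2 (hs.trans hu)) hu
  rw [hw]
  simp only at this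
  linarith

include ht ht' hw h in
/-- If equality holds at `s = 0`, the difference of the two logarithmic sums vanishes at both ends
of `[0, ∞)`; being monotone it is constant, and its derivative vanishes. -/
theorem sum_mul_inv_add_eq_of_sum_mul_log_eq
    (heq : ∑ i, w i * Real.log (t i) = ∑ k, w' k * Real.log (t' k)) {s : ℝ} (hs : 0 < s) :
    ∑ k, w' k * (s + t' k)⁻¹ = ∑ i, w i * (s + t i)⁻¹ := by
  have hd := (hasDerivAt_sum_mul_log_add (w := w) ht hs.le).sub
    (hasDerivAt_sum_mul_log_add (w := w') ht' hs.le)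
  have hzero : ∀ u : ℝ, 0 ≤ u →
      ∑ i, w i * Real.log (u + t i) - ∑ k, w' k * Real.log (u + t' k) = 0 := by
    intro u hu
    have h1 := monotoneOn_sum_mul_log_add_sub ht ht' h (Set.mem_Ici.2 le_rfl) (Set.mem_Ici.2 hu) hu
    have h2 := sum_mul_log_add_le ht ht' hw h hu
    simp only [zero_add] at h1
    linarith
  have hc : HasDerivAt
      (fun s : ℝ => ∑ i, w i * Real.log (s + t i) - ∑ k, w' k * Real.log (s + t' k)) 0 s :=
    (hasDerivAt_const s (0 : ℝ)).congr_of_eventuallyEq <| by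
      filter_upwards [eventually_ge_nhds hs] with u hu using hzero u hu
  have := hd.unique hc
  linarith

end Stieltjes

/-! ### Functional calculus in the eigenbases of two Hermitian matrices -/

section JointCalc

variable {n : Type*} [Fintype n] [DecidableEq n] {σ ρ : Matrix n n ℂ}

/-- The unitary matrix of eigenvectors, as a plain matrix. -/
def eigenMatrix (hρ : ρ.IsHermitian) : Matrix n n ℂ := hρ.eigenvectorUnitary

/-- The operator `∑ F(q_j, p_i) Q_j P_i`, where `σ = ∑ q_j Q_j` and `ρ = ∑ p_i P_i` are the spectral
decompositions. For `F x y = f (x / y)` it is `f(Δ)` applied to `1`, where `Δ X = σ X ρ⁻¹` is the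
relative modular operator. -/
def jointCalc (hσ : σ.IsHermitian) (hρ : ρ.IsHermitian) (F : ℝ → ℝ → ℝ) : Matrix n n ℂ :=
  eigenMatrix hσ *
    (Matrix.of fun j i => (F (hσ.eigenvalues j) (hρ.eigenvalues i) : ℂ)).hadamard
      ((eigenMatrix hσ)ᴴ * eigenMatrix hρ) *
    (eigenMatrix hρ)ᴴ

/-- The weight `p_i |⟨j|i⟩|²` of a pair of eigenvectors, `|j⟩` of `σ` and `|i⟩` of `ρ`. -/
def overlapWeight (hσ : σ.IsHermitian) (hρ : ρ.IsHermitian) (x : n × n) : ℝ :=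
  hρ.eigenvalues x.2 * Complex.normSq (((eigenMatrix hσ)ᴴ * eigenMatrix hρ) x.1 x.2)

/-- The eigenvalue `q_j / p_i` of the relative modular operator `X ↦ σ X ρ⁻¹`. -/
def eigenvalueRatio (hσ : σ.IsHermitian) (hρ : ρ.IsHermitian) (x : n × n) : ℝ :=
  hσ.eigenvalues x.1 / hρ.eigenvalues x.2

variable (hσ : σ.IsHermitian) (hρ : ρ.IsHermitian)

theorem conjTranspose_mul_eigenMatrix : (eigenMatrix hρ)ᴴ * eigenMatrix hρ = 1 :=
  Unitary.coe_star_mul_self hρ.eigenvectorUnitary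

theorem eigenMatrix_mul_conjTranspose : eigenMatrix hρ * (eigenMatrix hρ)ᴴ = 1 :=
  Unitary.coe_mul_star_self hρ.eigenvectorUnitary

theorem conjTranspose_eigenMatrix_mul_cancel (X : Matrix n n ℂ) :
    (eigenMatrix hρ)ᴴ * (eigenMatrix hρ * X) = X := by
  rw [← Matrix.mul_assoc, conjTranspose_mul_eigenMatrix, Matrix.one_mul]

theorem eigenMatrix_mul_cancel (X : Matrix n n ℂ) :
    eigenMatrix hρ * ((eigenMatrix hρ)ᴴ * X) = X := by
  rw [← Matrix.mul_assoc, eigenMatrix_mul_conjTranspose, Matrix.one_mul]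

theorem cfc_eq_eigenMatrix_mul_diagonal_mul (f : ℝ → ℝ) :
    cfc f ρ = eigenMatrix hρ *
      Matrix.diagonal (fun i => (f (hρ.eigenvalues i) : ℂ)) * (eigenMatrix hρ)ᴴ := by
  rw [hρ.cfc_eq, Matrix.IsHermitian.cfc, Unitary.conjStarAlgAut_apply]
  rfl

theorem cfc_mul_jointCalc_mul_cfc (f g : ℝ → ℝ) (F : ℝ → ℝ → ℝ) :
    cfc f σ * jointCalc hσ hρ F * cfc g ρ = jointCalc hσ hρ (fun x y => f x * F x y * g y) := by
  rw [cfc_eq_eigenMatrix_mul_diagonal_mul hσ, cfc_eq_eigenMatrix_mul_diagonal_mul hρ,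
    jointCalc, jointCalc]
  simp only [Matrix.mul_assoc, conjTranspose_eigenMatrix_mul_cancel]
  rw [← Matrix.mul_assoc (Matrix.hadamard _ _), ← Matrix.mul_assoc (Matrix.diagonal _)]
  congr 2
  ext j i
  rw [← Matrix.mul_assoc, Matrix.mul_diagonal, Matrix.diagonal_mul]
  simp only [Matrix.hadamard_apply, Matrix.of_apply, Complex.ofReal_mul]
  ring

theorem jointCalc_one : jointCalc hσ hρ (fun _ _ => 1) = 1 := by
  have : (Matrix.of fun _ _ => ((1 : ℝ) : ℂ)).hadamard
      ((eigenMatrix hσ)ᴴ * eigenMatrix hρ) = (eigenMatrix hσ)ᴴ * eigenMatrix hρ := by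
    ext j i; simp [Matrix.hadamard_apply]
  rw [jointCalc, this, eigenMatrix_mul_cancel, eigenMatrix_mul_conjTranspose]

theorem cfc_mul_cfc_eq_jointCalc (f g : ℝ → ℝ) :
    cfc f σ * cfc g ρ = jointCalc hσ hρ (fun x y => f x * g y) := by
  have := cfc_mul_jointCalc_mul_cfc hσ hρ f g (fun _ _ => 1)
  simpa [jointCalc_one] using this

theorem jointCalc_add (F G : ℝ → ℝ → ℝ) :
    jointCalc hσ hρ F + jointCalc hσ hρ G = jointCalc hσ hρ (fun x y => F x y + G x y) := by
  rw [jointCalc, jointCalc, jointCalc, ← Matrix.add_mul, ← Matrix.mul_add]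
  congr 2
  ext j i
  simp [Matrix.hadamard_apply, add_mul]

theorem smul_jointCalc (c : ℝ) (F : ℝ → ℝ → ℝ) :
    c • jointCalc hσ hρ F = jointCalc hσ hρ (fun x y => c * F x y) := by
  rw [jointCalc, jointCalc, ← Matrix.smul_mul, ← Matrix.mul_smul]
  congr 2
  ext j i
  simp [Matrix.hadamard_apply, mul_assoc]

theorem jointCalc_congr {F G : ℝ → ℝ → ℝ}
    (h : ∀ j i, F (hσ.eigenvalues j) (hρ.eigenvalues i) =
      G (hσ.eigenvalues j) (hρ.eigenvalues i)) :
    jointCalc hσ hρ F = jointCalc hσ hρ G := by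
  rw [jointCalc, jointCalc]
  simp only [h]

theorem jointCalc_zero : jointCalc hσ hρ (fun _ _ => 0) = 0 := by
  simpa using (smul_jointCalc hσ hρ 0 (fun _ _ => 0)).symm

theorem jointCalc_sum {ι : Type*} (S : Finset ι) (F : ι → ℝ → ℝ → ℝ) :
    ∑ s ∈ S, jointCalc hσ hρ (F s) = jointCalc hσ hρ (fun x y => ∑ s ∈ S, F s x y) := by
  classical
  induction S using Finset.induction_on with
  | empty => simp [jointCalc_zero]
  | insert s S hs ih => simp only [Finset.sum_insert hs, ih, jointCalc_add]

theorem trace_mul_jointCalc_re (F : ℝ → ℝ → ℝ) :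
    (ρ * jointCalc hσ hρ F).trace.re =
      ∑ x : n × n, overlapWeight hσ hρ x * F (hσ.eigenvalues x.1) (hρ.eigenvalues x.2) := by
  have h1 : (ρ * jointCalc hσ hρ F).trace =
      (Matrix.diagonal (fun i => (hρ.eigenvalues i : ℂ)) *
        (((eigenMatrix hσ)ᴴ * eigenMatrix hρ)ᴴ *
          (Matrix.of fun j i => (F (hσ.eigenvalues j) (hρ.eigenvalues i) : ℂ)).hadamard
            ((eigenMatrix hσ)ᴴ * eigenMatrix hρ))).trace := by
    have hρs : cfc (fun x : ℝ => x) ρ = ρ := cfc_id' ℝ ρ hρ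
    conv_lhs => enter [1, 1]; rw [← hρs, cfc_eq_eigenMatrix_mul_diagonal_mul hρ]
    rw [jointCalc, Matrix.conjTranspose_mul, Matrix.conjTranspose_conjTranspose,
      ← Matrix.mul_assoc, Matrix.trace_mul_comm]
    simp only [Matrix.mul_assoc, conjTranspose_eigenMatrix_mul_cancel]
  rw [h1, Matrix.trace, Complex.re_sum, Fintype.sum_prod_type, Finset.sum_comm]
  refine Finset.sum_congr rfl fun i _ => ?_
  rw [Matrix.diag_apply, Matrix.diagonal_mul, Matrix.mul_apply, Complex.re_ofReal_mul,
    Complex.re_sum, Finset.mul_sum]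
  refine Finset.sum_congr rfl fun j _ => ?_
  rw [Matrix.hadamard_apply, Matrix.of_apply, Matrix.conjTranspose_apply, overlapWeight]
  generalize ((eigenMatrix hσ)ᴴ * eigenMatrix hρ) j i = z
  have : star z * ((F (hσ.eigenvalues j) (hρ.eigenvalues i) : ℂ) * z) =
      ((F (hσ.eigenvalues j) (hρ.eigenvalues i) * Complex.normSq z : ℝ) : ℂ) := by
    rw [Complex.ofReal_mul, Complex.normSq_eq_conj_mul_self, Complex.star_def]
    ring
  rw [this, Complex.ofReal_re]
  ring

end JointCalc
/-! ### Powers of positive matrices -/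

section Powers

variable {n : Type*} [Fintype n] [DecidableEq n] {A : Matrix n n ℂ}

theorem continuousOn_spectrum (A : Matrix n n ℂ) (f : ℝ → ℝ) : ContinuousOn f (spectrum ℝ A) :=
  A.finite_real_spectrum.continuousOn f

theorem spectrum_pos_of_posDef (hA : A.PosDef) {x : ℝ} (hx : x ∈ spectrum ℝ A) : 0 < x := by
  rw [hA.isHermitian.spectrum_real_eq_range_eigenvalues] at hx
  obtain ⟨i, rfl⟩ := hx
  exact hA.eigenvalues_pos i

theorem spectrum_nonneg_of_posSemidef (hA : A.PosSemidef) {x : ℝ} (hx : x ∈ spectrum ℝ A) :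
    0 ≤ x := by
  rw [hA.isHermitian.spectrum_real_eq_range_eigenvalues] at hx
  obtain ⟨i, rfl⟩ := hx
  exact hA.eigenvalues_nonneg i

theorem isHermitian_mpow (A : Matrix n n ℂ) (s : ℝ) : (mpow A s).IsHermitian :=
  cfc_predicate (p := IsSelfAdjoint) _ _

theorem mpow_mul_mpow (hA : A.PosDef) (s t : ℝ) : mpow A s * mpow A t = mpow A (s + t) := by
  rw [mpow, mpow, ← cfc_mul _ _ A (continuousOn_spectrum A _) (continuousOn_spectrum A _)]
  exact cfc_congr fun x hx => (Real.rpow_add (spectrum_pos_of_posDef hA hx) s t).symm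

theorem mpow_zero (hA : A.IsHermitian) : mpow A 0 = 1 := by
  simp only [mpow, Real.rpow_zero]
  exact cfc_const_one ℝ A hA.isSelfAdjoint

theorem mpow_half_mul_mpow_half (hA : A.PosSemidef) : mpow A (1 / 2) * mpow A (1 / 2) = A := by
  rw [mpow, ← cfc_mul _ _ A (continuousOn_spectrum A _) (continuousOn_spectrum A _)]
  conv_rhs => rw [← cfc_id' ℝ A hA.isHermitian.isSelfAdjoint]
  refine cfc_congr fun x hx => ?_
  have h := spectrum_nonneg_of_posSemidef hA hx
  rw [← Real.sqrt_eq_rpow, Real.mul_self_sqrt h]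

theorem mpow_half_mul_mpow_neg_half (hA : A.PosDef) :
    mpow A (1 / 2) * mpow A (-(1 / 2)) = 1 := by
  rw [mpow_mul_mpow hA, add_neg_cancel, mpow_zero hA.isHermitian]

theorem mpow_neg_half_mul_mpow_half (hA : A.PosDef) :
    mpow A (-(1 / 2)) * mpow A (1 / 2) = 1 := by
  rw [mpow_mul_mpow hA, neg_add_cancel, mpow_zero hA.isHermitian]

theorem mpow_neg_half_mul_mul_mpow_neg_half (hA : A.PosDef) :
    mpow A (-(1 / 2)) * A * mpow A (-(1 / 2)) = 1 := by
  conv_lhs => enter [1, 2]; rw [← mpow_half_mul_mpow_half hA.posSemidef]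
  rw [← Matrix.mul_assoc, mpow_neg_half_mul_mpow_half hA, Matrix.one_mul,
    mpow_half_mul_mpow_neg_half hA]

theorem mpow_mul_self_half (hA : A.PosSemidef) : mpow (A * A) (1 / 2) = A := by
  have hAA : A * A = cfc (fun x : ℝ => x ^ 2) A := by
    rw [cfc_pow_id A 2 hA.isHermitian.isSelfAdjoint, sq]
  rw [mpow, hAA, ← cfc_comp' (fun x : ℝ => x ^ (1 / 2 : ℝ)) (fun x : ℝ => x ^ 2) A
    ((A.finite_real_spectrum.image _).continuousOn _) (continuousOn_spectrum A _)
    hA.isHermitian.isSelfAdjoint]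
  conv_rhs => rw [← cfc_id' ℝ A hA.isHermitian.isSelfAdjoint]
  refine cfc_congr fun x hx => ?_
  rw [← Real.sqrt_eq_rpow, Real.sqrt_sq (spectrum_nonneg_of_posSemidef hA hx)]

theorem posSemidef_mpow_half (hA : A.PosSemidef) : (mpow A (1 / 2)).PosSemidef := by
  have h : mpow A (1 / 2) = (mpow A (1 / 4))ᴴ * mpow A (1 / 4) := by
    rw [(isHermitian_mpow A _).eq, mpow, mpow,
      ← cfc_mul _ _ A (continuousOn_spectrum A _) (continuousOn_spectrum A _)]
    refine cfc_congr fun x hx => ?_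
    rw [← Real.rpow_add_of_nonneg (spectrum_nonneg_of_posSemidef hA hx) (by norm_num) (by norm_num)]
    norm_num
  rw [h]
  exact Matrix.posSemidef_conjTranspose_mul_self _

end Powers

/-! ### Monotonicity of the relative entropy and its equality case -/

section RelativeEntropy

variable {m n : Type*} [Fintype m] [DecidableEq m] [Fintype n] [DecidableEq n]

/-- The quantum relative entropy `D(ρ ‖ σ) = Tr ρ (log ρ - log σ)`. -/
def relEntropy (ρ σ : Matrix n n ℂ) : ℝ :=
  (ρ * mlog ρ).trace.re - (ρ * mlog σ).trace.re

theorem eigenvalueRatio_pos {ρ σ : Matrix n n ℂ} (hρ : ρ.PosDef) (hσ : σ.PosDef)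
    (x : n × n) : 0 < eigenvalueRatio hσ.isHermitian hρ.isHermitian x :=
  div_pos (hσ.eigenvalues_pos _) (hρ.eigenvalues_pos _)

theorem sum_overlapWeight {ρ σ : Matrix n n ℂ} (hρ : ρ.IsHermitian) (hσ : σ.IsHermitian) :
    ∑ x, overlapWeight hσ hρ x = ρ.trace.re := by
  have := trace_mul_jointCalc_re hσ hρ fun _ _ => 1
  simpa [jointCalc_one] using this.symm

theorem relEntropy_eq_neg_sum {ρ σ : Matrix n n ℂ} (hρ : ρ.PosDef) (hσ : σ.PosDef) :
    relEntropy ρ σ = -∑ x, overlapWeight hσ.isHermitian hρ.isHermitian x *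
      Real.log (eigenvalueRatio hσ.isHermitian hρ.isHermitian x) := by
  have h1 := cfc_mul_cfc_eq_jointCalc hσ.isHermitian hρ.isHermitian (fun _ => 1) Real.log
  have h2 := cfc_mul_cfc_eq_jointCalc hσ.isHermitian hρ.isHermitian Real.log (fun _ => 1)
  rw [cfc_const_one ℝ σ hσ.isHermitian.isSelfAdjoint, one_mul] at h1
  rw [cfc_const_one ℝ ρ hρ.isHermitian.isSelfAdjoint, mul_one] at h2
  rw [relEntropy, mlog, mlog, h1, h2, trace_mul_jointCalc_re, trace_mul_jointCalc_re,
    ← Finset.sum_sub_distrib, ← Finset.sum_neg_distrib]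
  refine Finset.sum_congr rfl fun x _ => ?_
  rw [eigenvalueRatio, Real.log_div (hσ.eigenvalues_pos _).ne' (hρ.eigenvalues_pos _).ne']
  ring

/-- The operator `(Δ + s)⁻¹` applied to `1`, where `Δ X = σ X ρ⁻¹` is the relative modular
operator. -/
def modularResolvent {ρ σ : Matrix n n ℂ} (hρ : ρ.PosDef) (hσ : σ.PosDef) (s : ℝ) : Matrix n n ℂ :=
  jointCalc hσ.isHermitian hρ.isHermitian fun x y => (s + x / y)⁻¹

theorem trace_mul_modularResolvent_re {ρ σ : Matrix n n ℂ} (hρ : ρ.PosDef) (hσ : σ.PosDef) (s : ℝ) :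
    (ρ * modularResolvent hρ hσ s).trace.re = ∑ x, overlapWeight hσ.isHermitian hρ.isHermitian x *
      (s + eigenvalueRatio hσ.isHermitian hρ.isHermitian x)⁻¹ :=
  trace_mul_jointCalc_re _ _ _

/-- The equation `(Δ + s) Z = 1`, multiplied by `ρ` from the right. -/
theorem modularResolvent_sylvester {ρ σ : Matrix n n ℂ} (hρ : ρ.PosDef) (hσ : σ.PosDef) {s : ℝ}
    (hs : 0 < s) : σ * modularResolvent hρ hσ s + s • (modularResolvent hρ hσ s * ρ) = ρ := by
  have h1 := cfc_mul_jointCalc_mul_cfc hσ.isHermitian hρ.isHermitian (fun x => x) (fun _ => 1)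
    fun x y => (s + x / y)⁻¹
  have h2 := cfc_mul_jointCalc_mul_cfc hσ.isHermitian hρ.isHermitian (fun _ => 1) (fun x => x)
    fun x y => (s + x / y)⁻¹
  have h3 := cfc_mul_cfc_eq_jointCalc hσ.isHermitian hρ.isHermitian (fun _ => 1) (fun x => x)
  rw [cfc_id' ℝ σ hσ.isHermitian.isSelfAdjoint, cfc_const_one ℝ ρ hρ.isHermitian.isSelfAdjoint,
    mul_one] at h1
  rw [cfc_id' ℝ ρ hρ.isHermitian.isSelfAdjoint, cfc_const_one ℝ σ hσ.isHermitian.isSelfAdjoint,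
    one_mul] at h2
  rw [cfc_id' ℝ ρ hρ.isHermitian.isSelfAdjoint, cfc_const_one ℝ σ hσ.isHermitian.isSelfAdjoint,
    one_mul] at h3
  conv_rhs => rw [h3]
  rw [modularResolvent, h1, h2, smul_jointCalc, jointCalc_add]
  refine jointCalc_congr _ _ fun j i => ?_
  have hx := hσ.eigenvalues_pos j
  have hy := hρ.eigenvalues_pos i
  field_simp
  ring

/-- The concave quadratic function `2 Re Tr ρZ - Tr σ Z Zᴴ - s Tr ρ Zᴴ Z`, whose maximizer is the
solution of `σ Z + s Z ρ = ρ`. -/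
def resolventForm (ρ σ : Matrix n n ℂ) (s : ℝ) (Z : Matrix n n ℂ) : ℝ :=
  2 * (ρ * Z).trace.re - (σ * (Z * Zᴴ)).trace.re - s * (ρ * (Zᴴ * Z)).trace.re

omit [DecidableEq n] in
theorem trace_re_eq_conjTranspose (X : Matrix n n ℂ) : X.trace.re = Xᴴ.trace.re := by
  rw [Matrix.trace_conjTranspose]; simp

omit [DecidableEq n] in
/-- Completion of the square: the form attains the maximal value `Re Tr ρZ₀` at the solution `Z₀` of
the Sylvester equation, and decreases quadratically away from it. -/
theorem resolventForm_add {ρ σ Z₀ : Matrix n n ℂ} (hρ : ρ.IsHermitian) (hσ : σ.IsHermitian) {s : ℝ}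
    (hZ₀ : σ * Z₀ + s • (Z₀ * ρ) = ρ) (N : Matrix n n ℂ) :
    resolventForm ρ σ s (Z₀ + N) = (ρ * Z₀).trace.re -
      ((σ * (N * Nᴴ)).trace.re + s * (ρ * (Nᴴ * N)).trace.re) := by
  -- The Sylvester equation tested against `Yᴴ`; with `Y = N` it cancels the terms linear in `N`,
  -- and with `Y = Z₀` it evaluates the form at `Z₀`.
  have key : ∀ Y : Matrix n n ℂ,
      (σ * (Z₀ * Yᴴ)).trace.re + s * (ρ * (Yᴴ * Z₀)).trace.re = (ρ * Y).trace.re := by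
    intro Y
    have h1 : (ρ * (Yᴴ * Z₀)).trace = (Z₀ * ρ * Yᴴ).trace := by
      rw [← Matrix.mul_assoc, Matrix.trace_mul_cycle]
    have h2 := congrArg (fun X : Matrix n n ℂ => (X * Yᴴ).trace.re) hZ₀
    simp only [Matrix.add_mul, Matrix.smul_mul, Matrix.trace_add, Matrix.trace_smul,
      Complex.add_re, Complex.smul_re, smul_eq_mul] at h2
    rw [h1, ← Matrix.mul_assoc, h2, trace_re_eq_conjTranspose (ρ * Yᴴ), Matrix.conjTranspose_mul,
      Matrix.conjTranspose_conjTranspose, hρ.eq, Matrix.trace_mul_comm]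
  have hZN := key N
  have hZZ := key Z₀
  have c1 : (σ * (N * Z₀ᴴ)).trace.re = (σ * (Z₀ * Nᴴ)).trace.re := by
    rw [trace_re_eq_conjTranspose, Matrix.conjTranspose_mul, Matrix.conjTranspose_mul,
      Matrix.conjTranspose_conjTranspose, hσ.eq, Matrix.trace_mul_comm]
  have c2 : (ρ * (Z₀ᴴ * N)).trace.re = (ρ * (Nᴴ * Z₀)).trace.re := by
    rw [trace_re_eq_conjTranspose, Matrix.conjTranspose_mul, Matrix.conjTranspose_mul,
      Matrix.conjTranspose_conjTranspose, hρ.eq, Matrix.trace_mul_comm]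
  simp only [resolventForm, Matrix.conjTranspose_add, Matrix.add_mul, Matrix.mul_add,
    Matrix.trace_add, Complex.add_re, c1, c2]
  linarith

omit [DecidableEq n] in
theorem trace_mul_conjTranspose_mul_self_re_nonneg {ρ : Matrix n n ℂ} (hρ : ρ.PosSemidef)
    (N : Matrix n n ℂ) :
    0 ≤ (ρ * (Nᴴ * N)).trace.re := by
  have h := (hρ.mul_mul_conjTranspose_same N).trace_nonneg
  rw [← Matrix.mul_assoc, Matrix.trace_mul_cycle]
  exact (Complex.le_def.1 h).1

theorem eq_zero_of_trace_mul_conjTranspose_mul_self_eq_zero {ρ : Matrix n n ℂ}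
    (hρ : ρ.PosDef) {N : Matrix n n ℂ} (h : (ρ * (Nᴴ * N)).trace.re = 0) : N = 0 := by
  set B := mpow ρ (1 / 2)
  have hB : Bᴴ = B := (isHermitian_mpow ρ _).eq
  have h1 : (ρ * (Nᴴ * N)).trace = ((N * B) * (N * B)ᴴ).trace := by
    rw [Matrix.conjTranspose_mul, hB, Matrix.mul_assoc, ← Matrix.mul_assoc B,
      mpow_half_mul_mpow_half hρ.posSemidef, ← Matrix.mul_assoc, ← Matrix.mul_assoc,
      Matrix.trace_mul_cycle]
  have h2 : (0 : ℂ) ≤ ((N * B) * (N * B)ᴴ).trace :=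
    (Matrix.posSemidef_self_mul_conjTranspose (N * B)).trace_nonneg
  rw [h1] at h
  have h3 : N * B = 0 := Matrix.trace_mul_conjTranspose_self_eq_zero_iff.1
    (Complex.ext h (Complex.le_def.1 h2).2.symm)
  calc N = N * B * mpow ρ (-(1 / 2)) := by
        rw [Matrix.mul_assoc, mpow_half_mul_mpow_neg_half hρ, Matrix.mul_one]
    _ = 0 := by rw [h3, Matrix.zero_mul]

/-- The map `Ψ` behaves like the adjoint of a channel that sends `ρ` to `ρ'` and `σ` to `σ'`: it is
compatible with the traces against `ρ` and `ρ'`, and it satisfies the Schwarz inequalities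
`Ψ(Z) Ψ(Z)ᴴ ≤ Ψ(Z Zᴴ)` and `Ψ(Z)ᴴ Ψ(Z) ≤ Ψ(Zᴴ Z)` after pairing with `σ` and `ρ`
respectively. Linearity of `Ψ` is not required. -/
structure IsSchwarzPullback (ρ σ : Matrix n n ℂ) (ρ' σ' : Matrix m m ℂ)
    (Ψ : Matrix m m ℂ → Matrix n n ℂ) : Prop where
  trace_eq : ρ.trace.re = ρ'.trace.re
  trace_mul : ∀ Z, (ρ * Ψ Z).trace.re = (ρ' * Z).trace.re
  schwarz_left : ∀ Z, (σ * (Ψ Z * (Ψ Z)ᴴ)).trace.re ≤ (σ' * (Z * Zᴴ)).trace.re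
  schwarz_right : ∀ Z, (ρ * ((Ψ Z)ᴴ * Ψ Z)).trace.re ≤ (ρ' * (Zᴴ * Z)).trace.re

namespace IsSchwarzPullback

variable {ρ σ : Matrix n n ℂ} {ρ' σ' : Matrix m m ℂ} {Ψ : Matrix m m ℂ → Matrix n n ℂ}

omit [DecidableEq m] [DecidableEq n] in
theorem resolventForm_le (h : IsSchwarzPullback ρ σ ρ' σ' Ψ) {s : ℝ} (hs : 0 < s)
    (Z : Matrix m m ℂ) : resolventForm ρ' σ' s Z ≤ resolventForm ρ σ s (Ψ Z) := by
  have h1 := h.trace_mul Z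
  have h2 := h.schwarz_left Z
  have h3 := mul_le_mul_of_nonneg_left (h.schwarz_right Z) hs.le
  simp only [resolventForm]
  linarith

/-- Comparison of the maximal values of the two quadratic forms, with a remainder that measures how
far the image of the maximizer for `(ρ', σ')` is from the maximizer for `(ρ, σ)`. -/
theorem trace_mul_modularResolvent_add_le (h : IsSchwarzPullback ρ σ ρ' σ' Ψ) (hρ : ρ.PosDef)
    (hσ : σ.PosDef) (hρ' : ρ'.PosDef) (hσ' : σ'.PosDef) {s : ℝ} (hs : 0 < s) :
    (ρ' * modularResolvent hρ' hσ' s).trace.re +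
      s * (ρ * ((Ψ (modularResolvent hρ' hσ' s) - modularResolvent hρ hσ s)ᴴ *
        (Ψ (modularResolvent hρ' hσ' s) - modularResolvent hρ hσ s))).trace.re ≤
      (ρ * modularResolvent hρ hσ s).trace.re := by
  have h1 := h.resolventForm_le hs (modularResolvent hρ' hσ' s)
  have h2 := resolventForm_add hρ'.isHermitian hσ'.isHermitian
    (modularResolvent_sylvester hρ' hσ' hs) 0
  have h3 := resolventForm_add hρ.isHermitian hσ.isHermitian (modularResolvent_sylvester hρ hσ hs)
    (Ψ (modularResolvent hρ' hσ' s) - modularResolvent hρ hσ s)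
  rw [add_sub_cancel] at h3
  have h4 := trace_mul_conjTranspose_mul_self_re_nonneg hσ.posSemidef
    (Ψ (modularResolvent hρ' hσ' s) - modularResolvent hρ hσ s)ᴴ
  rw [Matrix.conjTranspose_conjTranspose] at h4
  simp only [add_zero, Matrix.conjTranspose_zero, Matrix.mul_zero, Matrix.trace_zero,
    Complex.zero_re] at h2
  linarith

theorem trace_mul_modularResolvent_le (h : IsSchwarzPullback ρ σ ρ' σ' Ψ) (hρ : ρ.PosDef)
    (hσ : σ.PosDef) (hρ' : ρ'.PosDef) (hσ' : σ'.PosDef) {s : ℝ} (hs : 0 < s) :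
    (ρ' * modularResolvent hρ' hσ' s).trace.re ≤ (ρ * modularResolvent hρ hσ s).trace.re := by
  have h1 := h.trace_mul_modularResolvent_add_le hρ hσ hρ' hσ' hs
  have h2 := mul_nonneg hs.le (trace_mul_conjTranspose_mul_self_re_nonneg hρ.posSemidef
    (Ψ (modularResolvent hρ' hσ' s) - modularResolvent hρ hσ s))
  linarith

/-- Monotonicity of the relative entropy under a channel with adjoint `Ψ`. -/
theorem relEntropy_le (h : IsSchwarzPullback ρ σ ρ' σ' Ψ) (hρ : ρ.PosDef)
    (hσ : σ.PosDef) (hρ' : ρ'.PosDef) (hσ' : σ'.PosDef) : relEntropy ρ' σ' ≤ relEntropy ρ σ := by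
  rw [relEntropy_eq_neg_sum hρ hσ, relEntropy_eq_neg_sum hρ' hσ', neg_le_neg_iff]
  have := sum_mul_log_add_le (eigenvalueRatio_pos hρ hσ)
    (eigenvalueRatio_pos hρ' hσ')
    (w := overlapWeight hσ.isHermitian hρ.isHermitian)
    (w' := overlapWeight hσ'.isHermitian hρ'.isHermitian)
    (by rw [sum_overlapWeight, sum_overlapWeight, h.trace_eq])
    (fun s hs => by
      rw [← trace_mul_modularResolvent_re hρ hσ, ← trace_mul_modularResolvent_re hρ' hσ']
      exact h.trace_mul_modularResolvent_le hρ hσ hρ' hσ' hs) le_rfl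
  simpa using this

/-- In the equality case, the remainder in the comparison of the maximal values vanishes for every
`s`. -/
theorem map_modularResolvent_eq (h : IsSchwarzPullback ρ σ ρ' σ' Ψ) (hρ : ρ.PosDef)
    (hσ : σ.PosDef) (hρ' : ρ'.PosDef) (hσ' : σ'.PosDef)
    (heq : relEntropy ρ σ = relEntropy ρ' σ') {s : ℝ} (hs : 0 < s) :
    Ψ (modularResolvent hρ' hσ' s) = modularResolvent hρ hσ s := by
  rw [relEntropy_eq_neg_sum hρ hσ, relEntropy_eq_neg_sum hρ' hσ', neg_inj] at heq
  have h1 := sum_mul_inv_add_eq_of_sum_mul_log_eq (eigenvalueRatio_pos hρ hσ)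
    (eigenvalueRatio_pos hρ' hσ')
    (w := overlapWeight hσ.isHermitian hρ.isHermitian)
    (w' := overlapWeight hσ'.isHermitian hρ'.isHermitian)
    (by rw [sum_overlapWeight, sum_overlapWeight, h.trace_eq])
    (fun s hs => by
      rw [← trace_mul_modularResolvent_re hρ hσ, ← trace_mul_modularResolvent_re hρ' hσ']
      exact h.trace_mul_modularResolvent_le hρ hσ hρ' hσ' hs) heq hs
  rw [← trace_mul_modularResolvent_re hρ hσ, ← trace_mul_modularResolvent_re hρ' hσ'] at h1
  have h2 := h.trace_mul_modularResolvent_add_le hρ hσ hρ' hσ' hs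
  have h3 := trace_mul_conjTranspose_mul_self_re_nonneg hρ.posSemidef
    (Ψ (modularResolvent hρ' hσ' s) - modularResolvent hρ hσ s)
  refine sub_eq_zero.1 (eq_zero_of_trace_mul_conjTranspose_mul_self_eq_zero hρ (le_antisymm ?_ h3))
  exact nonpos_of_mul_nonpos_right (by linarith) hs

/-- In the equality case, `Φ` intertwines all functions of the relative modular operators, since
these are linear combinations of resolvents. -/
theorem map_jointCalc_eq {Φ : Matrix m m ℂ →ₗ[ℝ] Matrix n n ℂ}
    (h : IsSchwarzPullback ρ σ ρ' σ' Φ) (hρ : ρ.PosDef)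
    (hσ : σ.PosDef) (hρ' : ρ'.PosDef) (hσ' : σ'.PosDef)
    (heq : relEntropy ρ σ = relEntropy ρ' σ') (f : ℝ → ℝ) :
    Φ (jointCalc hσ'.isHermitian hρ'.isHermitian fun x y => f (x / y)) =
      jointCalc hσ.isHermitian hρ.isHermitian fun x y => f (x / y) := by
  classical
  -- A set containing the spectra of both modular operators, so that one combination of resolvents
  -- serves both sides.
  set T : Finset ℝ := Finset.univ.image (eigenvalueRatio hσ.isHermitian hρ.isHermitian) ∪
    Finset.univ.image (eigenvalueRatio hσ'.isHermitian hρ'.isHermitian) with hTdef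
  have hT : ∀ t ∈ T, 0 < t := by
    intro t ht
    simp only [hTdef, Finset.mem_union, Finset.mem_image, Finset.mem_univ, true_and] at ht
    rcases ht with ⟨x, rfl⟩ | ⟨x, rfl⟩
    · exact eigenvalueRatio_pos hρ hσ x
    · exact eigenvalueRatio_pos hρ' hσ' x
  obtain ⟨c, hc⟩ := exists_sum_inv_add_eq T hT f
  have h1 : jointCalc hσ.isHermitian hρ.isHermitian (fun x y => f (x / y)) =
      ∑ s ∈ T, c s • modularResolvent hρ hσ s := by
    simp only [modularResolvent, smul_jointCalc, jointCalc_sum]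
    exact jointCalc_congr _ _ fun j i => hc _ <| Finset.mem_union_left _ <|
      Finset.mem_image_of_mem (eigenvalueRatio hσ.isHermitian hρ.isHermitian)
        (Finset.mem_univ (j, i))
  have h2 : jointCalc hσ'.isHermitian hρ'.isHermitian (fun x y => f (x / y)) =
      ∑ s ∈ T, c s • modularResolvent hρ' hσ' s := by
    simp only [modularResolvent, smul_jointCalc, jointCalc_sum]
    exact jointCalc_congr _ _ fun j i => hc _ <| Finset.mem_union_right _ <|
      Finset.mem_image_of_mem (eigenvalueRatio hσ'.isHermitian hρ'.isHermitian)
        (Finset.mem_univ (j, i))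
  rw [h1, h2, map_sum]
  refine Finset.sum_congr rfl fun s hs => ?_
  rw [map_smul, h.map_modularResolvent_eq hρ hσ hρ' hσ' heq (hT s hs)]

theorem map_mpow_half_mul_mpow_neg_half {Φ : Matrix m m ℂ →ₗ[ℝ] Matrix n n ℂ}
    (h : IsSchwarzPullback ρ σ ρ' σ' Φ) (hρ : ρ.PosDef)
    (hσ : σ.PosDef) (hρ' : ρ'.PosDef) (hσ' : σ'.PosDef)
    (heq : relEntropy ρ σ = relEntropy ρ' σ') :
    Φ (mpow σ' (1 / 2) * mpow ρ' (-(1 / 2))) = mpow σ (1 / 2) * mpow ρ (-(1 / 2)) := by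
  have key : ∀ x y : ℝ, 0 < x → 0 < y →
      x ^ (1 / 2 : ℝ) * y ^ (-(1 / 2) : ℝ) = (x / y) ^ (1 / 2 : ℝ) := fun x y hx hy => by
    rw [Real.div_rpow hx.le hy.le, Real.rpow_neg hy.le, ← div_eq_mul_inv]
  have := h.map_jointCalc_eq hρ hσ hρ' hσ' heq fun t => t ^ (1 / 2 : ℝ)
  rw [mpow, mpow, mpow, mpow, cfc_mul_cfc_eq_jointCalc hσ'.isHermitian hρ'.isHermitian,
    cfc_mul_cfc_eq_jointCalc hσ.isHermitian hρ.isHermitian,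
    jointCalc_congr (G := fun x y => (x / y) ^ (1 / 2 : ℝ)) hσ'.isHermitian hρ'.isHermitian
      fun j i =>
      key _ _ (hσ'.eigenvalues_pos j) (hρ'.eigenvalues_pos i), this]
  exact (jointCalc_congr hσ.isHermitian hρ.isHermitian fun j i =>
    key _ _ (hσ.eigenvalues_pos j) (hρ.eigenvalues_pos i)).symm

end IsSchwarzPullback

end RelativeEntropy
/-! ### Partial traces and tensoring with the identity -/

section PartialTrace

variable {k m : Type*} [Fintype k] [DecidableEq k] [Fintype m] [DecidableEq m]

/-- The partial trace over the first tensor factor. -/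
def partialTraceLeft (ρ : Matrix (k × m) (k × m) ℂ) : Matrix m m ℂ :=
  Matrix.of fun x y => ∑ i, ρ (i, x) (i, y)

/-- The embedding `X ↦ 1 ⊗ X` as a `*`-homomorphism. -/
def oneKroneckerHom (k m : Type*) [Fintype k] [DecidableEq k] [Fintype m] [DecidableEq m] :
    Matrix m m ℂ →⋆ₐ[ℝ] Matrix (k × m) (k × m) ℂ where
  toFun X := (1 : Matrix k k ℂ) ⊗ₖ X
  map_one' := Matrix.one_kronecker_one
  map_mul' X Y := by rw [← Matrix.mul_kronecker_mul, Matrix.one_mul]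
  map_zero' := Matrix.kronecker_zero _
  map_add' X Y := Matrix.kronecker_add _ X Y
  commutes' r := by
    rw [Algebra.algebraMap_eq_smul_one, Algebra.algebraMap_eq_smul_one, Matrix.kronecker_smul,
      Matrix.one_kronecker_one]
  map_star' X := by
    rw [Matrix.star_eq_conjTranspose, Matrix.star_eq_conjTranspose, Matrix.conjTranspose_kronecker,
      Matrix.conjTranspose_one]

theorem oneKroneckerHom_apply (X : Matrix m m ℂ) :
    oneKroneckerHom k m X = (1 : Matrix k k ℂ) ⊗ₖ X := rfl

/-- The functional calculus commutes with `*`-homomorphisms; no continuity of `f` is needed since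
spectra are finite. -/
theorem map_cfc_matrix (φ : Matrix m m ℂ →⋆ₐ[ℝ] Matrix k k ℂ) {X : Matrix m m ℂ}
    (hX : X.IsHermitian) (f : ℝ → ℝ) : φ (cfc f X) = cfc f (φ X) := by
  have hφ : Continuous φ :=
    LinearMap.continuous_of_finiteDimensional (φ : Matrix m m ℂ →ₐ[ℝ] Matrix k k ℂ).toLinearMap
  exact StarAlgHomClass.map_cfc φ f X (continuousOn_spectrum X f) hφ hX.isSelfAdjoint
    (hX.isSelfAdjoint.map φ)

theorem map_mpow (φ : Matrix m m ℂ →⋆ₐ[ℝ] Matrix k k ℂ) {X : Matrix m m ℂ}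
    (hX : X.IsHermitian) (s : ℝ) : φ (mpow X s) = mpow (φ X) s := map_cfc_matrix φ hX _

theorem map_mlog (φ : Matrix m m ℂ →⋆ₐ[ℝ] Matrix k k ℂ) {X : Matrix m m ℂ}
    (hX : X.IsHermitian) : φ (mlog X) = mlog (φ X) := map_cfc_matrix φ hX _

/-- The partial trace is adjoint to tensoring with the identity. -/
theorem trace_partialTraceLeft_mul (ρ : Matrix (k × m) (k × m) ℂ) (X : Matrix m m ℂ) :
    (partialTraceLeft ρ * X).trace = (ρ * oneKroneckerHom k m X).trace := by
  have h : ∀ i x, (ρ * oneKroneckerHom k m X) (i, x) (i, x) = ∑ y, ρ (i, x) (i, y) * X y x := by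
    intro i x
    rw [Matrix.mul_apply, Fintype.sum_prod_type]
    simp [oneKroneckerHom_apply, Matrix.one_apply]
  simp only [Matrix.trace, Matrix.diag_apply, Fintype.sum_prod_type, h]
  simp only [Matrix.mul_apply, partialTraceLeft, Matrix.of_apply, Finset.sum_mul]
  exact (Finset.sum_congr rfl fun x _ => Finset.sum_comm).trans Finset.sum_comm

theorem trace_partialTraceLeft (ρ : Matrix (k × m) (k × m) ℂ) :
    (partialTraceLeft ρ).trace = ρ.trace := by
  simpa using trace_partialTraceLeft_mul ρ 1

theorem partialTraceLeft_mul_mul (X Y : Matrix m m ℂ) (ρ : Matrix (k × m) (k × m) ℂ) :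
    partialTraceLeft (oneKroneckerHom k m X * ρ * oneKroneckerHom k m Y) =
      X * partialTraceLeft ρ * Y := by
  refine Matrix.ext_iff_trace_mul_right.2 fun Z => ?_
  rw [trace_partialTraceLeft_mul, Matrix.mul_assoc, Matrix.mul_assoc, ← map_mul,
    Matrix.trace_mul_comm, Matrix.mul_assoc, ← map_mul, ← trace_partialTraceLeft_mul,
    Matrix.mul_assoc X, Matrix.mul_assoc X, Matrix.trace_mul_comm X, Matrix.mul_assoc,
    Matrix.mul_assoc, Matrix.mul_assoc]

omit [DecidableEq k] [Fintype m] [DecidableEq m] in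
theorem posDef_partialTraceLeft [Nonempty k] {ρ : Matrix (k × m) (k × m) ℂ} (hρ : ρ.PosDef) :
    (partialTraceLeft ρ).PosDef := by
  have : partialTraceLeft ρ = ∑ i, ρ.submatrix (Prod.mk i) (Prod.mk i) := by
    ext x y
    simp [partialTraceLeft, Matrix.sum_apply]
  rw [this]
  exact Matrix.posDef_sum Finset.univ_nonempty fun i _ => hρ.submatrix (Prod.mk_right_injective i)

end PartialTrace

/-! ### The Petz state and the conditional mutual information -/

section Tripartite

variable {a b c : Type*} [Fintype a] [Fintype b] [Fintype c]
  [DecidableEq a] [DecidableEq b] [DecidableEq c]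

/-- The exchange of the first two tensor factors. -/
def swapAB (a b c : Type*) : a × b × c ≃ b × a × c where
  toFun x := (x.2.1, (x.1, x.2.2))
  invFun x := (x.2.1, (x.1, x.2.2))
  left_inv _ := rfl
  right_inv _ := rfl

/-- Relabelling of rows and columns along an equivalence, as a `*`-homomorphism. -/
def reindexHom {k m : Type*} [Fintype k] [DecidableEq k] [Fintype m] [DecidableEq m] (e : k ≃ m) :
    Matrix m m ℂ →⋆ₐ[ℝ] Matrix k k ℂ where
  toFun X := X.submatrix e e
  map_one' := Matrix.submatrix_one_equiv e
  map_mul' X Y := (Matrix.submatrix_mul_equiv X Y e e e).symm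
  map_zero' := rfl
  map_add' _ _ := rfl
  commutes' r := by
    rw [Algebra.algebraMap_eq_smul_one, Algebra.algebraMap_eq_smul_one,
      ← Matrix.submatrix_one_equiv e]
    rfl
  map_star' _ := rfl

/-- `liftAC` as a `*`-homomorphism. -/
def liftACHom (a b c : Type*) [Fintype a] [Fintype b] [Fintype c]
    [DecidableEq a] [DecidableEq b] [DecidableEq c] :
    Matrix (a × c) (a × c) ℂ →⋆ₐ[ℝ] Matrix (a × b × c) (a × b × c) ℂ :=
  (reindexHom (swapAB a b c)).comp (oneKroneckerHom b (a × c))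

/-- `liftBC` as a `*`-homomorphism. -/
def liftBCHom (a b c : Type*) [Fintype a] [Fintype b] [Fintype c]
    [DecidableEq a] [DecidableEq b] [DecidableEq c] :
    Matrix (b × c) (b × c) ℂ →⋆ₐ[ℝ] Matrix (a × b × c) (a × b × c) ℂ :=
  oneKroneckerHom a (b × c)

theorem liftAC_eq (X : Matrix (a × c) (a × c) ℂ) : liftAC X = liftACHom a b c X := rfl

theorem liftBC_eq (X : Matrix (b × c) (b × c) ℂ) : liftBC X = liftBCHom a b c X := rfl

theorem liftC_eq_liftBCHom (X : Matrix c c ℂ) :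
    liftC X = liftBCHom a b c (oneKroneckerHom b c X) := rfl

theorem liftC_eq_liftACHom (X : Matrix c c ℂ) :
    liftC X = liftACHom a b c (oneKroneckerHom a c X) := by
  ext ⟨i, j, x⟩ ⟨i', j', y⟩
  change (1 : Matrix a a ℂ) i i' * ((1 : Matrix b b ℂ) j j' * X x y) =
    (1 : Matrix b b ℂ) j j' * ((1 : Matrix a a ℂ) i i' * X x y)
  ring

variable (ρ : Matrix (a × b × c) (a × b × c) ℂ)

omit [Fintype b] [Fintype c] [DecidableEq a] [DecidableEq b] [DecidableEq c] in
theorem margBC_eq : margBC ρ = partialTraceLeft ρ := rfl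

theorem margAC_eq : margAC ρ = partialTraceLeft (reindexHom (swapAB a b c).symm ρ) := rfl

omit [Fintype c] [DecidableEq a] [DecidableEq b] [DecidableEq c] in
theorem margC_eq_partialTraceLeft_margAC : margC ρ = partialTraceLeft (margAC ρ) := rfl

omit [Fintype c] [DecidableEq a] [DecidableEq b] [DecidableEq c] in
theorem margC_eq_partialTraceLeft_margBC : margC ρ = partialTraceLeft (margBC ρ) := by
  ext x y
  exact Finset.sum_comm

theorem trace_mul_liftACHom (X : Matrix (a × c) (a × c) ℂ) :
    (ρ * liftACHom a b c X).trace = (margAC ρ * X).trace := by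
  rw [margAC_eq, trace_partialTraceLeft_mul]
  have h : ρ * liftACHom a b c X = reindexHom (swapAB a b c)
      (reindexHom (swapAB a b c).symm ρ * oneKroneckerHom b (a × c) X) := by
    rw [map_mul]; rfl
  rw [h]
  exact Equiv.sum_comp (swapAB a b c) fun x =>
    (reindexHom (swapAB a b c).symm ρ * oneKroneckerHom b (a × c) X) x x

theorem trace_mul_liftBCHom (X : Matrix (b × c) (b × c) ℂ) :
    (ρ * liftBCHom a b c X).trace = (margBC ρ * X).trace :=
  (trace_partialTraceLeft_mul ρ X).symm

theorem margBC_liftACHom (X : Matrix (a × c) (a × c) ℂ) :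
    margBC (liftACHom a b c X) = oneKroneckerHom b c (partialTraceLeft X) := by
  ext ⟨j, x⟩ ⟨j', y⟩
  change ∑ i, (1 : Matrix b b ℂ) j j' * X (i, x) (i, y) =
    (1 : Matrix b b ℂ) j j' * ∑ i, X (i, x) (i, y)
  rw [Finset.mul_sum]

variable {ρ}

omit [Fintype b] [Fintype c] [DecidableEq a] [DecidableEq b] [DecidableEq c] in
theorem posDef_margBC [Nonempty a] (hρ : ρ.PosDef) : (margBC ρ).PosDef :=
  posDef_partialTraceLeft hρ

omit [Fintype a] [Fintype c] [DecidableEq a] [DecidableEq b] [DecidableEq c] in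
theorem posDef_margAC [Nonempty b] (hρ : ρ.PosDef) : (margAC ρ).PosDef :=
  posDef_partialTraceLeft (hρ.submatrix (swapAB a b c).symm.injective)

omit [Fintype c] [DecidableEq a] [DecidableEq b] [DecidableEq c] in
theorem posDef_margC [Nonempty a] [Nonempty b] (hρ : ρ.PosDef) : (margC ρ).PosDef := by
  rw [margC_eq_partialTraceLeft_margAC]
  exact posDef_partialTraceLeft (posDef_margAC hρ)

theorem posDef_oneKroneckerHom {k m : Type*} [Fintype k] [DecidableEq k] [Fintype m]
    [DecidableEq m] {X : Matrix m m ℂ} (hX : X.PosDef) : (oneKroneckerHom k m X).PosDef :=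
  Matrix.PosDef.one.kronecker hX

theorem posDef_liftACHom {X : Matrix (a × c) (a × c) ℂ} (hX : X.PosDef) :
    (liftACHom a b c X).PosDef :=
  (posDef_oneKroneckerHom hX).submatrix (swapAB a b c).injective

theorem condMutualInfo_eq_relEntropy_sub [Nonempty a] [Nonempty b] (hρ : ρ.PosDef) :
    condMutualInfo ρ = relEntropy ρ (liftACHom a b c (margAC ρ)) -
      relEntropy (margBC ρ) (oneKroneckerHom b c (margC ρ)) := by
  rw [relEntropy, relEntropy, ← map_mlog _ (posDef_margAC hρ).isHermitian,
    ← map_mlog _ (posDef_margC hρ).isHermitian, trace_mul_liftACHom, ← trace_partialTraceLeft_mul,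
    ← margC_eq_partialTraceLeft_margBC]
  simp only [condMutualInfo, entropy]
  ring

/-- The trace over `A` sends `ρ_ABC` to `ρ_BC` and `ρ_AC ⊗ 1_B` to `1_B ⊗ ρ_C`. Its adjoint is a
`*`-homomorphism, so the Schwarz inequalities are equalities. -/
theorem isSchwarzPullback_liftBCHom :
    IsSchwarzPullback ρ (liftACHom a b c (margAC ρ)) (margBC ρ) (oneKroneckerHom b c (margC ρ))
      (liftBCHom a b c).toAlgHom.toLinearMap where
  trace_eq := by rw [margBC_eq, trace_partialTraceLeft]
  trace_mul Z := congrArg Complex.re (trace_mul_liftBCHom ρ Z)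
  schwarz_left Z := by
    change ((liftACHom a b c (margAC ρ)) * (liftBCHom a b c Z * star (liftBCHom a b c Z))).trace.re
      ≤ _
    rw [← map_star, ← map_mul, trace_mul_liftBCHom, margBC_liftACHom,
      ← margC_eq_partialTraceLeft_margAC]
    rfl
  schwarz_right Z := by
    change (ρ * (star (liftBCHom a b c Z) * liftBCHom a b c Z)).trace.re ≤ _
    rw [← map_star, ← map_mul, trace_mul_liftBCHom]
    rfl

/-- The Kraus factor `K = ρ_AC^(1/2) ρ_C^(-1/2)` of the Petz recovery map `X ↦ K X Kᴴ` from `BC` to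
`ABC`. -/
def petzFactor (ρ : Matrix (a × b × c) (a × b × c) ℂ) : Matrix (a × b × c) (a × b × c) ℂ :=
  liftAC (mpow (margAC ρ) (1 / 2)) * liftC (mpow (margC ρ) (-(1 / 2)))

theorem conjTranspose_petzFactor :
    (petzFactor ρ)ᴴ = liftC (mpow (margC ρ) (-(1 / 2))) * liftAC (mpow (margAC ρ) (1 / 2)) := by
  rw [petzFactor, liftAC_eq, liftC_eq_liftACHom, ← Matrix.star_eq_conjTranspose, star_mul,
    ← map_star, ← map_star, ← map_star, Matrix.star_eq_conjTranspose, Matrix.star_eq_conjTranspose,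
    (isHermitian_mpow _ _).eq, (isHermitian_mpow _ _).eq]

theorem petzState_eq : petzState ρ = petzFactor ρ * liftBC (margBC ρ) * (petzFactor ρ)ᴴ := by
  rw [conjTranspose_petzFactor, petzFactor, petzState]
  simp only [Matrix.mul_assoc]

/-- The Petz recovery map preserves the trace; dually, its adjoint is unital. -/
theorem margBC_conjTranspose_petzFactor_mul [Nonempty a] [Nonempty b] (hρ : ρ.PosDef) :
    margBC ((petzFactor ρ)ᴴ * petzFactor ρ) = 1 := by
  have h : (petzFactor ρ)ᴴ * petzFactor ρ =
      liftBCHom a b c (oneKroneckerHom b c (mpow (margC ρ) (-(1 / 2)))) *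
        liftACHom a b c (margAC ρ) *
        liftBCHom a b c (oneKroneckerHom b c (mpow (margC ρ) (-(1 / 2)))) := by
    rw [conjTranspose_petzFactor, petzFactor, liftC_eq_liftBCHom, liftAC_eq, Matrix.mul_assoc,
      ← Matrix.mul_assoc (liftACHom a b c _), ← map_mul,
      mpow_half_mul_mpow_half (posDef_margAC hρ).posSemidef, Matrix.mul_assoc]
  have h1 := mpow_neg_half_mul_mul_mpow_neg_half (posDef_margC hρ)
  rw [h, margBC_eq, liftBCHom, partialTraceLeft_mul_mul, ← margBC_eq, margBC_liftACHom,
    ← margC_eq_partialTraceLeft_margAC, ← map_mul, ← map_mul, h1, map_one]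

/-- The Petz recovery map sends `1_B ⊗ ρ_C` to `ρ_AC ⊗ 1_B`. -/
theorem petzFactor_mul_liftC_mul [Nonempty a] [Nonempty b] (hρ : ρ.PosDef) :
    petzFactor ρ * liftC (margC ρ) * (petzFactor ρ)ᴴ = liftACHom a b c (margAC ρ) := by
  have h1 := mpow_neg_half_mul_mul_mpow_neg_half (posDef_margC hρ)
  rw [conjTranspose_petzFactor, petzFactor, liftC_eq_liftACHom, liftC_eq_liftACHom, liftAC_eq,
    ← map_mul, ← map_mul, ← map_mul, ← map_mul, Matrix.mul_assoc, Matrix.mul_assoc,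
    ← Matrix.mul_assoc (oneKroneckerHom a c (margC ρ)), ← map_mul, ← Matrix.mul_assoc
    (oneKroneckerHom a c _), ← map_mul, ← Matrix.mul_assoc (mpow (margC ρ) _), h1, map_one,
    Matrix.one_mul, mpow_half_mul_mpow_half (posDef_margAC hρ).posSemidef]

omit [Fintype b] [Fintype c] [DecidableEq a] [DecidableEq b] [DecidableEq c] in
theorem margBC_conjTranspose (M : Matrix (a × b × c) (a × b × c) ℂ) :
    margBC Mᴴ = (margBC M)ᴴ := by
  ext x y
  simp [margBC, Matrix.conjTranspose_apply]

omit [DecidableEq a] [DecidableEq b] [DecidableEq c] in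
theorem margBC_mul_conjTranspose_mul (K Z : Matrix (a × b × c) (a × b × c) ℂ) :
    margBC (Kᴴ * Zᴴ * K) = (margBC (Kᴴ * Z * K))ᴴ := by
  rw [← margBC_conjTranspose, Matrix.conjTranspose_mul, Matrix.conjTranspose_mul,
    Matrix.conjTranspose_conjTranspose, Matrix.mul_assoc]

/-- Schwarz inequality for the unital completely positive map `Z ↦ Tr_A (Kᴴ Z K)`, paired with
`T`. -/
theorem margBC_schwarz {K : Matrix (a × b × c) (a × b × c) ℂ} (hK : margBC (Kᴴ * K) = 1)
    {T : Matrix (b × c) (b × c) ℂ} (hT : T.PosDef) (Z : Matrix (a × b × c) (a × b × c) ℂ) :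
    (T * ((margBC (Kᴴ * Z * K))ᴴ * margBC (Kᴴ * Z * K))).trace.re ≤
      (K * liftBC T * Kᴴ * (Zᴴ * Z)).trace.re := by
  set W := margBC (Kᴴ * Z * K) with hW
  set φ := liftBCHom a b c
  -- Positivity of `(Z K - K W)ᴴ (Z K - K W)`: of the four terms, all but the first have the same
  -- trace against `T`.
  have h0 := trace_mul_conjTranspose_mul_self_re_nonneg
    (posDef_oneKroneckerHom (k := a) hT).posSemidef (Z * K - K * φ W)
  change 0 ≤ (φ T * _).trace.re at h0
  have hφ : ∀ X, (φ X)ᴴ = φ Xᴴ := fun X => (map_star φ X).symm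
  have hm : ∀ M X, (φ X * M).trace = (X * margBC M).trace := fun M X => by
    rw [Matrix.trace_mul_comm, trace_mul_liftBCHom, Matrix.trace_mul_comm]
  have hWs : margBC (Kᴴ * Zᴴ * K) = Wᴴ := margBC_mul_conjTranspose_mul K Z
  have e1 : (φ T * ((Z * K)ᴴ * (Z * K))).trace = (K * φ T * Kᴴ * (Zᴴ * Z)).trace := by
    rw [Matrix.conjTranspose_mul, Matrix.mul_assoc K, Matrix.mul_assoc K, Matrix.trace_mul_comm K]
    simp only [Matrix.mul_assoc]
  have e2 : (φ T * ((K * φ W)ᴴ * (Z * K))).trace = (T * (Wᴴ * W)).trace := by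
    rw [Matrix.conjTranspose_mul, hφ, Matrix.mul_assoc, ← Matrix.mul_assoc, ← map_mul,
      ← Matrix.mul_assoc Kᴴ, hm, Matrix.mul_assoc]
  have e3 : (φ T * ((Z * K)ᴴ * (K * φ W))).trace = (T * (Wᴴ * W)).trace := by
    rw [Matrix.conjTranspose_mul, ← Matrix.mul_assoc _ K, ← Matrix.mul_assoc, Matrix.trace_mul_comm,
      ← Matrix.mul_assoc, ← map_mul, hm, hWs, Matrix.mul_assoc, Matrix.trace_mul_comm,
      Matrix.mul_assoc]
  have e4 : (φ T * ((K * φ W)ᴴ * (K * φ W))).trace = (T * (Wᴴ * W)).trace := by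
    rw [Matrix.conjTranspose_mul, hφ, Matrix.mul_assoc, ← Matrix.mul_assoc (φ T), ← map_mul,
      ← Matrix.mul_assoc Kᴴ, ← Matrix.mul_assoc, Matrix.trace_mul_comm, ← Matrix.mul_assoc,
      ← map_mul, hm, hK, Matrix.mul_one, Matrix.trace_mul_comm, Matrix.mul_assoc]
  rw [Matrix.conjTranspose_sub, Matrix.sub_mul, Matrix.mul_sub, Matrix.mul_sub, Matrix.mul_sub,
    Matrix.mul_sub, Matrix.mul_sub, Matrix.trace_sub, Matrix.trace_sub, Matrix.trace_sub,
    e1, e2, e3, e4] at h0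
  simp only [Complex.sub_re] at h0
  change _ ≤ (K * φ T * Kᴴ * (Zᴴ * Z)).trace.re
  linarith

/-- If `ρ` equals its Petz state, then the Petz recovery map sends `ρ_BC` to `ρ_ABC` and
`1_B ⊗ ρ_C` to `ρ_AC ⊗ 1_B`. -/
theorem isSchwarzPullback_petz [Nonempty a] [Nonempty b] (hρ : ρ.PosDef) (h : ρ = petzState ρ) :
    IsSchwarzPullback (margBC ρ) (oneKroneckerHom b c (margC ρ)) ρ (liftACHom a b c (margAC ρ))
      (fun Z => margBC ((petzFactor ρ)ᴴ * Z * petzFactor ρ)) where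
  trace_eq := by rw [margBC_eq, trace_partialTraceLeft]
  trace_mul Z := by
    conv_rhs => rw [h, petzState_eq]
    rw [Matrix.trace_mul_comm, ← trace_mul_liftBCHom, Matrix.trace_mul_comm,
      Matrix.mul_assoc (petzFactor ρ), Matrix.mul_assoc (petzFactor ρ),
      Matrix.trace_mul_comm (petzFactor ρ)]
    simp only [Matrix.mul_assoc]
    rfl
  schwarz_left Z := by
    have h1 := margBC_schwarz (margBC_conjTranspose_petzFactor_mul hρ)
      (posDef_oneKroneckerHom (k := b) (posDef_margC hρ)) Zᴴ
    change _ ≤ (petzFactor ρ * liftC (margC ρ) * (petzFactor ρ)ᴴ * _).trace.re at h1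
    rwa [petzFactor_mul_liftC_mul hρ, margBC_mul_conjTranspose_mul,
      Matrix.conjTranspose_conjTranspose, Matrix.conjTranspose_conjTranspose] at h1
  schwarz_right Z := by
    have h1 := margBC_schwarz (margBC_conjTranspose_petzFactor_mul hρ) (posDef_margBC hρ) Z
    rwa [← petzState_eq, ← h] at h1

theorem condMutualInfo_eq_zero_of_eq_petzState [Nonempty a] [Nonempty b] (hρ : ρ.PosDef)
    (h : ρ = petzState ρ) : condMutualInfo ρ = 0 := by
  have hAC := posDef_liftACHom (b := b) (posDef_margAC hρ)
  have hC := posDef_oneKroneckerHom (k := b) (posDef_margC hρ)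
  have h1 := (isSchwarzPullback_petz hρ h).relEntropy_le (posDef_margBC hρ) hC hρ hAC
  have h2 := isSchwarzPullback_liftBCHom.relEntropy_le hρ hAC (posDef_margBC hρ) hC
  rw [condMutualInfo_eq_relEntropy_sub hρ]
  linarith

/-- The equality case of monotonicity gives `ρ_AC^(1/2) ρ_ABC^(-1/2) = ρ_C^(1/2) ρ_BC^(-1/2)`, hence
`Kᴴ = ρ_BC^(-1/2) ρ_ABC^(1/2)` for the factor `K = ρ_AC^(1/2) ρ_C^(-1/2)`, and `K ρ_BC Kᴴ`
collapses to `ρ_ABC`. -/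
theorem eq_petzState_of_condMutualInfo_eq_zero [Nonempty a] [Nonempty b] (hρ : ρ.PosDef)
    (h : condMutualInfo ρ = 0) : ρ = petzState ρ := by
  have hAC := posDef_liftACHom (b := b) (posDef_margAC hρ)
  have hC := posDef_oneKroneckerHom (k := b) (posDef_margC hρ)
  rw [condMutualInfo_eq_relEntropy_sub hρ, sub_eq_zero] at h
  have h1 := isSchwarzPullback_liftBCHom.map_mpow_half_mul_mpow_neg_half hρ hAC
    (posDef_margBC hρ) hC h
  change liftBCHom a b c _ = _ at h1
  rw [← map_mpow _ (posDef_margAC hρ).isHermitian, ← map_mpow _ (posDef_margC hρ).isHermitian,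
    map_mul] at h1
  set φ := liftBCHom a b c
  set S := liftACHom a b c (mpow (margAC ρ) (1 / 2))
  set R := mpow ρ (1 / 2)
  set Q := φ (mpow (margBC ρ) (-(1 / 2)))
  have hQ : Qᴴ = Q := by
    rw [← Matrix.star_eq_conjTranspose, ← map_star, Matrix.star_eq_conjTranspose,
      (isHermitian_mpow _ _).eq]
  have hR : Rᴴ = R := (isHermitian_mpow _ _).eq
  have hcancel : φ (oneKroneckerHom b c (mpow (margC ρ) (-(1 / 2)))) *
      φ (oneKroneckerHom b c (mpow (margC ρ) (1 / 2))) = 1 := by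
    rw [← map_mul, ← map_mul, mpow_neg_half_mul_mpow_half (posDef_margC hρ), map_one, map_one]
  have h2 : (petzFactor ρ)ᴴ = Q * R := by
    rw [conjTranspose_petzFactor, liftC_eq_liftBCHom]
    change φ (oneKroneckerHom b c (mpow (margC ρ) (-(1 / 2)))) * S = Q * R
    calc _ = φ (oneKroneckerHom b c (mpow (margC ρ) (-(1 / 2)))) *
          (S * mpow ρ (-(1 / 2))) * R := by
          rw [Matrix.mul_assoc, Matrix.mul_assoc, mpow_neg_half_mul_mpow_half hρ, Matrix.mul_one]
      _ = Q * R := by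
          rw [← h1, ← Matrix.mul_assoc, hcancel, Matrix.one_mul]
  have h3 : petzFactor ρ = R * Q := by
    rw [← Matrix.conjTranspose_conjTranspose (petzFactor ρ), h2, Matrix.conjTranspose_mul, hQ, hR]
  have h4 : Q * φ (margBC ρ) * Q = 1 := by
    rw [← map_mul, ← map_mul, mpow_neg_half_mul_mul_mpow_neg_half (posDef_margBC hρ), map_one]
  rw [petzState_eq, h2, h3]
  change _ = R * Q * φ (margBC ρ) * (Q * R)
  calc ρ = R * R := (mpow_half_mul_mpow_half hρ.posSemidef).symm
    _ = R * (Q * φ (margBC ρ) * Q) * R := by rw [h4, Matrix.mul_one]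
    _ = R * Q * φ (margBC ρ) * (Q * R) := by simp only [Matrix.mul_assoc]

theorem posDef_petzState [Nonempty a] [Nonempty b] (hρ : ρ.PosDef) : (petzState ρ).PosDef := by
  have hu : IsUnit (petzFactor ρ) := by
    rw [petzFactor, liftAC_eq, liftC_eq_liftBCHom]
    refine IsUnit.mul (IsUnit.map _ ?_) (IsUnit.map _ (IsUnit.map _ ?_))
    · exact IsUnit.of_mul_eq_one _ (mpow_half_mul_mpow_neg_half (posDef_margAC hρ))
    · exact IsUnit.of_mul_eq_one _ (mpow_neg_half_mul_mpow_half (posDef_margC hρ))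
  rw [petzState_eq]
  exact (Matrix.IsUnit.posDef_star_right_conjugate_iff hu).2
    (posDef_oneKroneckerHom (posDef_margBC hρ))

theorem trace_petzState [Nonempty a] [Nonempty b] (hρ : ρ.PosDef) :
    (petzState ρ).trace = ρ.trace := by
  rw [petzState_eq, Matrix.mul_assoc, Matrix.trace_mul_comm, Matrix.mul_assoc,
    Matrix.trace_mul_comm, liftBC_eq, trace_mul_liftBCHom, margBC_conjTranspose_petzFactor_mul hρ,
    Matrix.one_mul, margBC_eq, trace_partialTraceLeft]

end Tripartite

/-! ### Vanishing of the min- and max-relative entropies -/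

section Divergences

variable {n : Type*} [Fintype n] [DecidableEq n] {ρ σ : Matrix n n ℂ}

theorem traceNorm_nonneg (X : Matrix n n ℂ) : 0 ≤ traceNorm X :=
  (Complex.le_def.1 (posSemidef_mpow_half
    (Matrix.posSemidef_conjTranspose_mul_self X)).trace_nonneg).1

/-- With `√ρ √σ = U P` the polar decomposition, `‖√ρ U - √σ‖₂² = 2 - 2 Tr P`, so that trace norm one
forces `√σ = √ρ U` and `σ = ρ`. -/
theorem dMin_eq_zero_iff_traceNorm :
    dMin ρ σ = 0 ↔ traceNorm (mpow ρ (1 / 2) * mpow σ (1 / 2)) = 1 := by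
  rw [dMin, EReal.neg_eq_zero_iff, ENNReal.log_eq_one_iff, ENNReal.ofReal_eq_one, fidelity,
    pow_eq_one_iff_of_nonneg (traceNorm_nonneg _) two_ne_zero]

theorem dMin_eq_zero_iff (hρ : ρ.PosDef) (hσ : σ.PosDef) (hρ1 : ρ.trace = 1) (hσ1 : σ.trace = 1) :
    dMin ρ σ = 0 ↔ ρ = σ := by
  rw [dMin_eq_zero_iff_traceNorm]
  constructor
  · intro h
    set R := mpow ρ (1 / 2)
    set S := mpow σ (1 / 2)
    have hR : Rᴴ = R := (isHermitian_mpow _ _).eq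
    have hS : Sᴴ = S := (isHermitian_mpow _ _).eq
    have hXpd : ((R * S)ᴴ * (R * S)).PosDef := by
      refine Matrix.PosDef.conjTranspose_mul_self _ (Matrix.mulVec_injective_of_isUnit ?_)
      exact (IsUnit.of_mul_eq_one _ (mpow_half_mul_mpow_neg_half hρ)).mul
        (IsUnit.of_mul_eq_one _ (mpow_half_mul_mpow_neg_half hσ))
    set P := mpow ((R * S)ᴴ * (R * S)) (1 / 2)
    set N := mpow ((R * S)ᴴ * (R * S)) (-(1 / 2))
    have hN : Nᴴ = N := (isHermitian_mpow _ _).eq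
    have hPN : P * N = 1 := mpow_half_mul_mpow_neg_half hXpd
    have hNP : N * P = 1 := mpow_neg_half_mul_mpow_half hXpd
    have hPP : P * P = (R * S)ᴴ * (R * S) := mpow_half_mul_mpow_half hXpd.posSemidef
    set U := R * S * N with hU
    have hUR : Uᴴ * (R * S) = P := by
      rw [hU, Matrix.conjTranspose_mul, hN, Matrix.mul_assoc, ← hPP, ← Matrix.mul_assoc, hNP,
        Matrix.one_mul]
    have hUU : Uᴴ * U = 1 := by
      rw [hU, ← Matrix.mul_assoc, ← hU, hUR, hPN]
    have hUU' : U * Uᴴ = 1 := mul_eq_one_comm.1 hUU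
    have htr : (Uᴴ * (R * S)).trace.re = 1 := by rw [hUR]; exact h
    have htr' : ((S * R) * U).trace.re = 1 := by
      have : ((S * R) * U) = (Uᴴ * (R * S))ᴴ := by
        simp [Matrix.conjTranspose_mul, hR, hS, Matrix.mul_assoc]
      rw [this, Matrix.trace_conjTranspose]
      simpa using htr
    have hz : ((R * U - S)ᴴ * (R * U - S)).trace.re = 0 := by
      have e1 : (Uᴴ * R * (R * U)).trace = 1 := by
        rw [Matrix.mul_assoc, ← Matrix.mul_assoc R, mpow_half_mul_mpow_half hρ.posSemidef,
          Matrix.trace_mul_comm, Matrix.mul_assoc, hUU', Matrix.mul_one, hρ1]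
      have e2 : (S * S).trace = 1 := by rw [mpow_half_mul_mpow_half hσ.posSemidef, hσ1]
      rw [Matrix.conjTranspose_sub, Matrix.conjTranspose_mul, hR, hS, Matrix.sub_mul,
        Matrix.mul_sub, Matrix.mul_sub, Matrix.trace_sub, Matrix.trace_sub, Matrix.trace_sub,
        e1, e2, Matrix.mul_assoc Uᴴ, ← Matrix.mul_assoc S]
      simp only [Complex.sub_re, htr, htr', Complex.one_re]
      norm_num
    have h0 : R * U - S = 0 := by
      refine Matrix.trace_conjTranspose_mul_self_eq_zero_iff.1 (Complex.ext hz ?_)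
      exact (Complex.le_def.1 (Matrix.posSemidef_conjTranspose_mul_self
        (R * U - S)).trace_nonneg).2.symm
    have hSRU : S = R * U := (sub_eq_zero.1 h0).symm
    calc ρ = R * R := (mpow_half_mul_mpow_half hρ.posSemidef).symm
      _ = R * (U * Uᴴ) * Rᴴ := by rw [hUU', Matrix.mul_one, hR]
      _ = S * Sᴴ := by
        conv_rhs => rw [hSRU, Matrix.conjTranspose_mul]
        simp only [Matrix.mul_assoc]
      _ = σ := by rw [hS, mpow_half_mul_mpow_half hσ.posSemidef]
  · rintro rfl
    rw [mpow_half_mul_mpow_half hρ.posSemidef, traceNorm, hρ.isHermitian.eq,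
      mpow_mul_self_half hρ.posSemidef, hρ1, Complex.one_re]

omit [DecidableEq n] in
theorem nonneg_of_posSemidef_exp_smul_sub (hρ1 : ρ.trace = 1) (hσ1 : σ.trace = 1) {l : ℝ}
    (h : (Real.exp l • σ - ρ).PosSemidef) : 0 ≤ l := by
  have := (Complex.le_def.1 h.trace_nonneg).1
  rw [Matrix.trace_sub, Matrix.trace_smul, hρ1, hσ1, Complex.sub_re, Complex.smul_re,
    Complex.one_re, smul_eq_mul, mul_one, Complex.zero_re, sub_nonneg] at this
  exact Real.one_le_exp_iff.1 this

omit [DecidableEq n] in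
/-- If the infimum is `0` then `ρ ≤ exp(ε) σ` for all `ε > 0`, hence `ρ ≤ σ`, and equality of the
traces forces `ρ = σ`. -/
theorem dMax_eq_zero_iff (hσ : σ.PosDef) (hρ : ρ.IsHermitian) (hρ1 : ρ.trace = 1)
    (hσ1 : σ.trace = 1) : dMax ρ σ = 0 ↔ ρ = σ := by
  constructor
  · intro h
    have hpsd : (σ - ρ).PosSemidef := by
      have hH := hσ.isHermitian.sub hρ
      refine Matrix.PosSemidef.of_dotProduct_mulVec_nonneg hH fun x => ?_
      refine Complex.le_def.2 ⟨?_, (hH.im_star_dotProduct_mulVec_self x).symm⟩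
      set A := (star x ⬝ᵥ σ *ᵥ x).re
      set B := (star x ⬝ᵥ ρ *ᵥ x).re
      have hA : 0 ≤ A := (Complex.le_def.1 (hσ.posSemidef.dotProduct_mulVec_nonneg x)).1
      have hB : ∀ ε : ℝ, 0 < ε → B ≤ Real.exp ε * A := by
        intro ε hε
        have hlt : dMax ρ σ < (ε : EReal) := by rw [h]; exact EReal.coe_pos.2 hε
        obtain ⟨_, ⟨l, hl, rfl⟩, hlε⟩ := sInf_lt_iff.1 hlt
        have h1 := (Complex.le_def.1 (Matrix.PosSemidef.dotProduct_mulVec_nonneg hl x)).1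
        rw [Matrix.sub_mulVec, dotProduct_sub, Matrix.smul_mulVec, dotProduct_smul,
          Complex.sub_re, Complex.smul_re, Complex.zero_re, smul_eq_mul, sub_nonneg] at h1
        exact h1.trans (mul_le_mul_of_nonneg_right
          (Real.exp_le_exp.2 (EReal.coe_lt_coe_iff.1 hlε).le) hA)
      have hlim : Filter.Tendsto (fun ε : ℝ => Real.exp ε * A) (nhdsWithin 0 (Set.Ioi 0))
          (nhds (Real.exp 0 * A)) :=
        ((Real.continuous_exp.mul continuous_const).tendsto 0).mono_left nhdsWithin_le_nhds
      have hBA : B ≤ Real.exp 0 * A := ge_of_tendsto hlim <| by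
        filter_upwards [self_mem_nhdsWithin] with ε hε using hB ε hε
      rw [Real.exp_zero, one_mul] at hBA
      rw [Matrix.sub_mulVec, dotProduct_sub, Complex.sub_re, Complex.zero_re]
      exact sub_nonneg.2 hBA
    have := hpsd.trace_eq_zero_iff.1 (by rw [Matrix.trace_sub, hρ1, hσ1, sub_self])
    exact (sub_eq_zero.1 this).symm
  · rintro rfl
    refine le_antisymm (sInf_le ⟨0, ?_, rfl⟩) (le_sInf ?_)
    · simpa using Matrix.PosSemidef.zero
    · rintro _ ⟨l, hl, rfl⟩
      exact EReal.coe_nonneg.2 (nonneg_of_posSemidef_exp_smul_sub hρ1 hσ1 hl)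

end Divergences
end QInfo
end

theorem mainTheorem8 {a b c : Type*} [Fintype a] [Fintype b] [Fintype c]
    [DecidableEq a] [DecidableEq b] [DecidableEq c]
    (ρ : Matrix (a × b × c) (a × b × c) ℂ) (hρ : QInfo.IsPosDefDensity ρ) :
    (QInfo.iMax ρ = 0 ↔ QInfo.IsShortMarkovChain ρ) ∧
      (QInfo.iMin ρ = 0 ↔ QInfo.IsShortMarkovChain ρ) := by
  -- Trace one excludes empty index types, which the positivity of the marginals needs.
  have hne : Nonempty (a × b × c) := by
    by_contra hempty
    rw [not_nonempty_iff] at hempty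
    have := hρ.trace_eq_one
    rw [Matrix.trace, Finset.univ_eq_empty, Finset.sum_empty] at this
    exact zero_ne_one this
  obtain ⟨⟨i, j, -⟩⟩ := hne
  have : Nonempty a := ⟨i⟩
  have : Nonempty b := ⟨j⟩
  have hω := QInfo.posDef_petzState hρ.posDef
  have hω1 := (QInfo.trace_petzState hρ.posDef).trans hρ.trace_eq_one
  have key : ρ = QInfo.petzState ρ ↔ QInfo.IsShortMarkovChain ρ :=
    ⟨fun h => ⟨⟨hρ.posDef.posSemidef, hρ.trace_eq_one⟩,
      QInfo.condMutualInfo_eq_zero_of_eq_petzState hρ.posDef h⟩,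
      fun h => QInfo.eq_petzState_of_condMutualInfo_eq_zero hρ.posDef h.2⟩
  exact ⟨(QInfo.dMax_eq_zero_iff hω hρ.posDef.isHermitian hρ.trace_eq_one hω1).trans key,
    (QInfo.dMin_eq_zero_iff hρ.posDef hω hρ.trace_eq_one hω1).trans key⟩
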